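/- Let $K=\mathbb F_2^{\mathrm{alg}}$ be the algebraic closure of the field with two elements, and let $\mathrm{SL}_2(K)$ be the (discrete) group of $2\times 2$ matrices over $K$ of determinant $1$. A group $G$ is *amenable* if there is a finitely additive probability measure on the set of all subsets of $G$ that is invariant under left multiplication by elements of $G$. For nonempty finite subsets $S,T\subseteq G$ and $\epsilon>0$, the set $T$ is an *$(S,\epsilon)$-c-Følner set* if $|gTg^{-1}\,\triangle\, T|<\epsilon|T|$ for all $g\in S$. A group $G$ is *uniformly inner amenable* if there is a function $f:\mathbb N\to\mathbb N$ such that, for every $n\ge 1$ and every nonempty finite subset $S\subseteq G$ with $|S|\le n$, there is an $(S,\frac1n)$-c-Følner set $T\subseteq G$ with $n\le |T|\le f(n)$. **Corollary.** $\mathrm{SL}_2(K)$ is an amenable group that is not uniformly inner amenable. -/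

import Mathlib

open scoped Pointwise symmDiff

/-- An action of a group `G` on a set `X` is amenable if there is a finitely additive,
`G`-invariant probability measure defined on all subsets of `X`. -/
def IsAmenableAction (G X : Type*) [Group G] [MulAction G X] : Prop :=
  ∃ μ : Set X → ℝ,
    (∀ A, 0 ≤ μ A) ∧
    μ Set.univ = 1 ∧
    (∀ A B, Disjoint A B → μ (A ∪ B) = μ A + μ B) ∧
    (∀ (g : G) (A : Set X), μ (g • A) = μ A)

/-- A (discrete) group is amenable if its action on itself by left multiplication is amenable. -/
def IsAmenableGroup (G : Type*) [Group G] : Prop :=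
  IsAmenableAction G G

open Classical in
/-- `T` is an `(S, ε)`-c-Følner set, for finite subsets `S`, `T` of `G` with `T` nonempty:
`|g T g⁻¹ ∆ T| < ε |T|` for all `g ∈ S`. -/
def IsConjFolnerSet {G : Type*} [Group G] (S : Finset G) (ε : ℝ) (T : Finset G) : Prop :=
  T.Nonempty ∧
    ∀ g ∈ S, (((T.image fun t => g * t * g⁻¹) ∆ T).card : ℝ) < ε * (T.card : ℝ)

/-- `G` is uniformly inner amenable if there is `f : ℕ → ℕ` such that for all `n ≥ 1` and all
nonempty finite `S ⊆ G` with `|S| ≤ n` there is an `(S, 1/n)`-c-Følner set `T ⊆ G` with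
`n ≤ |T| ≤ f n`. -/
def IsUniformlyInnerAmenable (G : Type*) [Group G] : Prop :=
  ∃ f : ℕ → ℕ, ∀ n : ℕ, 1 ≤ n → ∀ S : Finset G, S.Nonempty → S.card ≤ n →
    ∃ T : Finset G, n ≤ T.card ∧ T.card ≤ f n ∧ IsConjFolnerSet S (1 / (n : ℝ)) T

/-!
Suppose that `G` acts on `X` so that every element outside a finite normal subgroup has between
`1` and `k` fixed points. Since `g` maps the fixed points of `t` to those of `g * t * g⁻¹`, counting
the fixed points of a set `T` which is almost invariant under conjugation gives an almost invariant
finitely additive measure on `X`, whose total mass is comparable to the size of `T`. If `a • B ⊆ B`,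
then `B \ a • B` has small measure; if moreover finitely many translates of `B \ a • B` cover `X`,
then `T` is small, so `G` is not uniformly inner amenable.

Over an algebraically closed field, noncentral elements of `SL₂` have one or two fixed points on the
projective line. Given a nontrivial valuation, let `B` be the closed unit ball and `a` a diagonal
matrix shrinking it: three translates of the annulus `B \ a • B` cover the projective line.

An algebraic extension of a finite field has no nontrivial valuation. But uniformity in the
definition of uniform inner amenability makes it pass to ultrapowers, and `SL₂` commutes with these.
An ultrapower of an infinite field has an element that is not integral over `ℤ`, hence lies outside
some valuation ring of its algebraic closure. Amenability holds because the group is locally finite.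
-/

open MulAction

section ConjDefect

variable {G H : Type*} [Group G] [Group H]

open Classical in
/-- The number of elements of `T` that conjugation by `g` moves out of `T`, which is half of
`|g T g⁻¹ ∆ T|`. -/
noncomputable def conjDefect (g : G) (T : Finset G) : ℕ :=
  (T.filter fun t => g * t * g⁻¹ ∉ T).card

open Classical in
theorem card_conj_symmDiff (g : G) (T : Finset G) :
    ((T.image fun t => g * t * g⁻¹) ∆ T).card = 2 * conjDefect g T := by
  have hinj : Function.Injective fun t => g * t * g⁻¹ := (MulAut.conj g).injective
  have hcard : ((T.image fun t => g * t * g⁻¹) \ T).card = conjDefect g T := by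
    rw [Finset.sdiff_eq_filter, Finset.filter_image, Finset.card_image_of_injective _ hinj,
      conjDefect]
  rw [symmDiff_def, Finset.sup_eq_union, Finset.card_union_of_disjoint disjoint_sdiff_sdiff,
    ← Finset.card_sdiff_comm (Finset.card_image_of_injective T hinj), hcard, two_mul]

theorem isConjFolnerSet_iff {S T : Finset G} {ε : ℝ} :
    IsConjFolnerSet S ε T ↔
      T.Nonempty ∧ ∀ g ∈ S, 2 * (conjDefect g T : ℝ) < ε * (T.card : ℝ) := by
  simp only [IsConjFolnerSet, card_conj_symmDiff, Nat.cast_mul, Nat.cast_ofNat]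

theorem IsConjFolnerSet.mul_conjDefect_lt {S T : Finset G} {n : ℕ} (hn : 0 < n)
    (hT : IsConjFolnerSet S (1 / (n : ℝ)) T) {g : G} (hg : g ∈ S) :
    2 * n * conjDefect g T < T.card := by
  have h := (isConjFolnerSet_iff.1 hT).2 g hg
  rw [one_div_mul_eq_div, lt_div_iff₀ (by positivity)] at h
  have h' : (2 * n * conjDefect g T : ℝ) < T.card := by linarith
  exact_mod_cast h'

open Classical in
theorem conjDefect_image {T : Finset G} {θ : G → H} (hθ : Set.InjOn θ T) {g : G} {h : H}
    (hconj : ∀ x ∈ T, ∀ y ∈ T, h * θ x * h⁻¹ = θ y ↔ g * x * g⁻¹ = y) :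
    conjDefect h (T.image θ) = conjDefect g T := by
  rw [conjDefect, conjDefect, Finset.filter_image,
    Finset.card_image_of_injOn (hθ.mono (Finset.filter_subset _ _))]
  congr 1
  refine Finset.filter_congr fun x hx => not_congr ?_
  grind

end ConjDefect

section FixedPointCount

variable {G X : Type*} [Group G] [MulAction G X]

theorem ncard_smul_inter_fixedBy_conj (g t : G) (D : Set X) :
    ((g • D) ∩ fixedBy X (g * t * g⁻¹)).ncard = (D ∩ fixedBy X t).ncard := by
  rw [← smul_fixedBy, ← Set.smul_set_inter]
  exact Set.ncard_image_of_injective _ (MulAction.injective g)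

open Classical in
/-- The number of pairs of an element of `T` outside `N` and a fixed point of it in `D`: a finitely
additive measure on `X` which is almost invariant when `T` is almost invariant under
conjugation. -/
noncomputable def fixedPointCount (N : Subgroup G) (T : Finset G) (D : Set X) : ℕ :=
  ∑ t ∈ T with t ∉ N, (D ∩ fixedBy X t).ncard

variable {N : Subgroup G} (T : Finset G)

theorem fixedPointCount_mono (hfin : ∀ t ∉ N, (fixedBy X t).Finite) {C D : Set X} (h : C ⊆ D) :
    fixedPointCount N T C ≤ fixedPointCount N T D := by
  classical
  refine Finset.sum_le_sum fun t ht => ?_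
  exact Set.ncard_le_ncard (Set.inter_subset_inter_left _ h)
    ((hfin t (Finset.mem_filter.1 ht).2).inter_of_right D)

theorem fixedPointCount_union_le (C D : Set X) :
    fixedPointCount N T (C ∪ D) ≤ fixedPointCount N T C + fixedPointCount N T D := by
  classical
  simp only [fixedPointCount, ← Finset.sum_add_distrib, Set.union_inter_distrib_right]
  exact Finset.sum_le_sum fun t _ => Set.ncard_union_le _ _

theorem fixedPointCount_biUnion_le {ι : Type*} (P : Finset ι) (D : ι → Set X) :
    fixedPointCount N T (⋃ p ∈ P, D p) ≤ ∑ p ∈ P, fixedPointCount N T (D p) := by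
  classical
  induction P using Finset.induction_on with
  | empty => simp [fixedPointCount]
  | insert p P hp ih =>
    rw [Finset.set_biUnion_insert, Finset.sum_insert hp]
    exact (fixedPointCount_union_le T _ _).trans (Nat.add_le_add_left ih _)

theorem fixedPointCount_sdiff_add (hfin : ∀ t ∉ N, (fixedBy X t).Finite) {C D : Set X}
    (h : C ⊆ D) :
    fixedPointCount N T (D \ C) + fixedPointCount N T C = fixedPointCount N T D := by
  classical
  simp only [fixedPointCount, ← Finset.sum_add_distrib]
  refine Finset.sum_congr rfl fun t ht => ?_
  rw [Set.inter_sdiff_distrib_right]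
  exact Set.ncard_sdiff_add_ncard_of_subset (Set.inter_subset_inter_left _ h)
    ((hfin t (Finset.mem_filter.1 ht).2).inter_of_right D)

open Classical in
theorem card_filter_notMem_le_fixedPointCount_univ
    (hpos : ∀ t ∉ N, 1 ≤ (fixedBy X t).ncard) :
    (T.filter (· ∉ N)).card ≤ fixedPointCount N T (Set.univ : Set X) := by
  rw [fixedPointCount, Finset.card_eq_sum_ones]
  refine Finset.sum_le_sum fun t ht => ?_
  simpa only [Set.univ_inter] using hpos t (Finset.mem_filter.1 ht).2

theorem fixedPointCount_le_smul_add [N.Normal] {k : ℕ}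
    (hfin : ∀ t ∉ N, (fixedBy X t).Finite) (hk : ∀ t ∉ N, (fixedBy X t).ncard ≤ k)
    (g : G) (D : Set X) :
    fixedPointCount N T D ≤ fixedPointCount N T (g • D) + k * conjDefect g T := by
  classical
  rw [fixedPointCount, ← Finset.sum_filter_add_sum_filter_not _ fun t => g * t * g⁻¹ ∈ T]
  have hstay : ∑ t ∈ T with t ∉ N ∧ g * t * g⁻¹ ∈ T, (D ∩ fixedBy X t).ncard ≤
      fixedPointCount N T (g • D) := by
    simp_rw [fixedPointCount, ← ncard_smul_inter_fixedBy_conj g _ D]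
    rw [← Finset.sum_image (f := fun t => ((g • D) ∩ fixedBy X t).ncard)
      (g := fun t => g * t * g⁻¹) (MulAut.conj g).injective.injOn]
    refine Finset.sum_le_sum_of_subset fun t ht => ?_
    simp only [Finset.mem_image, Finset.mem_filter] at ht ⊢
    obtain ⟨u, ⟨-, huN, huT⟩, rfl⟩ := ht
    exact ⟨huT, fun h => huN (by simpa [mul_assoc] using ‹N.Normal›.conj_mem _ h g⁻¹)⟩
  have hleave : ∑ t ∈ T with t ∉ N ∧ g * t * g⁻¹ ∉ T, (D ∩ fixedBy X t).ncard ≤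
      k * conjDefect g T := by
    rw [mul_comm, ← smul_eq_mul]
    refine (Finset.sum_le_card_nsmul _ _ k fun t ht => ?_).trans (nsmul_le_nsmul_left zero_le
      (Finset.card_le_card (Finset.monotone_filter_right T fun t _ ht => ht.2)))
    have htN := (Finset.mem_filter.1 ht).2.1
    exact (Set.ncard_le_ncard Set.inter_subset_right (hfin t htN)).trans (hk t htN)
  simpa only [Finset.filter_filter] using Nat.add_le_add hstay hleave

open Classical in
theorem card_filter_notMem_le [N.Normal] {k : ℕ}
    (hfix : ∀ t ∉ N, (fixedBy X t).ncard ∈ Set.Icc 1 k) {a : G} {B : Set X} (ha : a • B ⊆ B)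
    {P : Finset G} (hP : ∀ x, ∃ p ∈ P, p • x ∈ B \ a • B) :
    (T.filter (· ∉ N)).card ≤ k * (P.card * conjDefect a T + ∑ p ∈ P, conjDefect p T) := by
  set C := B \ a • B
  have hfin (t : G) (ht : t ∉ N) : (fixedBy X t).Finite := Set.finite_of_ncard_pos (hfix t ht).1
  have hle {g : G} {D : Set X} := fixedPointCount_le_smul_add T hfin (fun t ht => (hfix t ht).2) g D
  have hC : fixedPointCount N T C ≤ k * conjDefect a T := by
    have hsplit : fixedPointCount N T C + fixedPointCount N T (a • B) = fixedPointCount N T B :=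
      fixedPointCount_sdiff_add T hfin ha
    have hcontract := hle (g := a) (D := B)
    omega
  have hcover : Set.univ ⊆ ⋃ p ∈ P, p⁻¹ • C := fun x _ => by
    obtain ⟨p, hp, hpx⟩ := hP x
    exact Set.mem_biUnion hp (Set.mem_inv_smul_set_iff.2 hpx)
  have htranslate (p : G) :
      fixedPointCount N T (p⁻¹ • C) ≤ k * conjDefect a T + k * conjDefect p T := by
    refine hle.trans (Nat.add_le_add_right ?_ _)
    rwa [smul_inv_smul]
  calc (T.filter (· ∉ N)).card
      ≤ fixedPointCount N T (Set.univ : Set X) :=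
        card_filter_notMem_le_fixedPointCount_univ T fun t ht => (hfix t ht).1
    _ ≤ fixedPointCount N T (⋃ p ∈ P, p⁻¹ • C) := fixedPointCount_mono T hfin hcover
    _ ≤ ∑ p ∈ P, fixedPointCount N T (p⁻¹ • C) := fixedPointCount_biUnion_le T P _
    _ ≤ ∑ p ∈ P, (k * conjDefect a T + k * conjDefect p T) :=
        Finset.sum_le_sum fun p _ => htranslate p
    _ = k * (P.card * conjDefect a T + ∑ p ∈ P, conjDefect p T) := by
        rw [Finset.sum_add_distrib, Finset.sum_const, ← Finset.mul_sum, smul_eq_mul]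
        ring

theorem not_isUniformlyInnerAmenable_of_smul_cover [N.Normal] [Finite N] {k : ℕ}
    (hfix : ∀ t ∉ N, (fixedBy X t).ncard ∈ Set.Icc 1 k) {a : G} {B : Set X} (ha : a • B ⊆ B)
    {P : Finset G} (hP : ∀ x, ∃ p ∈ P, p • x ∈ B \ a • B) :
    ¬ IsUniformlyInnerAmenable G := by
  classical
  rintro ⟨f, hf⟩
  set n := 2 * k * P.card + 2 * Nat.card N + P.card + 1
  obtain ⟨T, hnT, -, hT⟩ := hf n (by omega) (insert a P) (Finset.insert_nonempty a P)
    ((Finset.card_insert_le a P).trans (by omega))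
  have hdefect {g : G} (hg : g ∈ insert a P) : 2 * n * conjDefect g T ≤ T.card :=
    (hT.mul_conjDefect_lt (by omega) hg).le
  have hN : (T.filter (· ∈ N)).card ≤ Nat.card N := by
    rw [← SetLike.coe_sort_coe, Nat.card_coe_set_eq, ← Set.ncard_coe_finset]
    exact Set.ncard_le_ncard fun t ht => (Finset.mem_filter.1 ht).2
  have hsum : 2 * n * (P.card * conjDefect a T + ∑ p ∈ P, conjDefect p T) ≤
      2 * P.card * T.card := by
    have ha' := Nat.mul_le_mul_left P.card (hdefect (Finset.mem_insert_self a P))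
    have hP' := Finset.sum_le_card_nsmul P _ _ fun p hp => hdefect (Finset.mem_insert_of_mem hp)
    rw [← Finset.mul_sum, smul_eq_mul] at hP'
    linarith
  have hcard : T.card ≤
      Nat.card N + k * (P.card * conjDefect a T + ∑ p ∈ P, conjDefect p T) := by
    rw [← T.card_filter_add_card_filter_not (· ∈ N)]
    exact Nat.add_le_add hN (card_filter_notMem_le T hfix ha hP)
  have hbound : 2 * n * T.card ≤ n * (2 * Nat.card N) + n * T.card := by
    calc 2 * n * T.card
        ≤ 2 * n * Nat.card N +
            k * (2 * n * (P.card * conjDefect a T + ∑ p ∈ P, conjDefect p T)) := by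
          linarith [Nat.mul_le_mul_left (2 * n) hcard]
      _ ≤ 2 * n * Nat.card N + k * (2 * P.card * T.card) := by gcongr
      _ = n * (2 * Nat.card N) + 2 * k * P.card * T.card := by ring
      _ ≤ n * (2 * Nat.card N) + n * T.card := by gcongr; omega
  have hsmall : T.card ≤ 2 * Nat.card N :=
    Nat.le_of_mul_le_mul_left (c := n) (by linarith) (by omega)
  omega

end FixedPointCount

section ProjectiveLine

open Matrix OnePoint

theorem ncard_fixedBy_onePoint_mem_Icc {F : Type*} [Field F] [DecidableEq F] [IsAlgClosed F]
    {g : GL (Fin 2) F} (hg : g ∉ Subgroup.center (GL (Fin 2) F)) :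
    (fixedBy (OnePoint F) g).ncard ∈ Set.Icc 1 2 := by
  have hp : g.fixpointPolynomial ≠ 0 := by
    rwa [Ne, GeneralLinearGroup.fixpointPolynomial_eq_zero_iff,
      ← GeneralLinearGroup.mem_center_iff_val_mem_range_scalar]
  have hcoe (c : F) : (c : OnePoint F) ∈ fixedBy (OnePoint F) g ↔
      c ∈ g.fixpointPolynomial.rootSet F := by
    rw [Polynomial.mem_rootSet_of_ne hp, GeneralLinearGroup.fixpointPolynomial_aeval_eq_zero_iff,
      mem_fixedBy]
  have hroots := g.fixpointPolynomial.ncard_rootSet_le F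
  have hncard := Set.ncard_image_of_injective (g.fixpointPolynomial.rootSet F)
    (coe_injective (X := F))
  by_cases h : g 1 0 = 0
  · have hfix : fixedBy (OnePoint F) g =
        insert ∞ ((↑) '' g.fixpointPolynomial.rootSet F) := by
      ext x
      cases x <;> simp [hcoe, smul_infty_eq_self_iff, h]
    have hdeg : g.fixpointPolynomial.natDegree ≤ 1 := by
      rw [GeneralLinearGroup.fixpointPolynomial, h, map_zero, zero_mul, zero_add]
      compute_degree
    rw [hfix, Set.ncard_insert_of_notMem infty_notMem_image_coe
      ((g.fixpointPolynomial.rootSet_finite F).image _), hncard, Set.mem_Icc]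
    omega
  · have hfix : fixedBy (OnePoint F) g = (↑) '' g.fixpointPolynomial.rootSet F := by
      ext x
      cases x <;> simp [hcoe, smul_infty_eq_self_iff, h]
    have hdeg : g.fixpointPolynomial.natDegree = 2 := by
      rw [GeneralLinearGroup.fixpointPolynomial]
      compute_degree!
    have hne : (g.fixpointPolynomial.rootSet F).Nonempty := by
      obtain ⟨c, hc⟩ := IsAlgClosed.exists_aeval_eq_zero F g.fixpointPolynomial
        (Polynomial.degree_ne_of_natDegree_ne (n := 0) (by omega))
      exact ⟨c, (Polynomial.mem_rootSet_of_ne hp).2 hc⟩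
    rw [hfix, hncard]
    exact ⟨(Set.ncard_pos (g.fixpointPolynomial.rootSet_finite F)).2 hne, hdeg ▸ hroots⟩

theorem finite_center_specialLinearGroup (n R : Type*) [Fintype n] [DecidableEq n] [CommRing R]
    [IsDomain R] : Finite (Subgroup.center (SpecialLinearGroup n R)) := by
  have : NeZero (max (Fintype.card n) 1) := ⟨by omega⟩
  exact .of_equiv _ SpecialLinearGroup.center_equiv_rootsOfUnity.symm.toEquiv

end ProjectiveLine

section Annulus

open Matrix OnePoint

variable {F Γ : Type*} [Field F] [LinearOrderedCommGroupWithZero Γ] (v : Valuation F Γ)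

/-- The closed ball of radius `r` centred at `0` in the affine part of the projective line. -/
def projectiveClosedBall (r : Γ) : Set (OnePoint F) :=
  (↑) '' {x : F | v x ≤ r}

@[simp]
theorem coe_mem_projectiveClosedBall {x : F} {r : Γ} :
    (x : OnePoint F) ∈ projectiveClosedBall v r ↔ v x ≤ r := by
  simp [projectiveClosedBall]

theorem projectiveClosedBall_mono {r s : Γ} (h : r ≤ s) :
    projectiveClosedBall v r ⊆ projectiveClosedBall v s :=
  Set.image_mono fun _ hx => le_trans hx h

variable [DecidableEq F]

theorem diag2_smul_coe {t : F} (ht : t ≠ 0) (x : F) :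
    SpecialLinearGroup.toGL (SpecialLinearGroup.diag2 t ht) • (x : OnePoint F) =
      ↑(t ^ 2 * x) := by
  simp [smul_some_eq_ite, SpecialLinearGroup.diag2_coe', ht, sq, mul_right_comm]

theorem transvection_zero_one_smul_coe (b x : F) :
    SpecialLinearGroup.toGL (SpecialLinearGroup.transvection (zero_ne_one' (Fin 2)) b) •
      (x : OnePoint F) = ↑(x + b) := by
  simp [smul_some_eq_ite, SpecialLinearGroup.transvection_coe]

theorem transvection_one_zero_smul_coe {b x : F} (h : b * x + 1 ≠ 0) :
    SpecialLinearGroup.toGL (SpecialLinearGroup.transvection (one_ne_zero' (Fin 2)) b) •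
      (x : OnePoint F) = ↑(x / (b * x + 1)) := by
  simp [smul_some_eq_ite, SpecialLinearGroup.transvection_coe, h]

theorem transvection_one_zero_smul_infty {b : F} (hb : b ≠ 0) :
    SpecialLinearGroup.toGL (SpecialLinearGroup.transvection (one_ne_zero' (Fin 2)) b) •
      (∞ : OnePoint F) = ↑b⁻¹ := by
  simp [smul_infty_eq_ite, SpecialLinearGroup.transvection_coe, hb]

theorem diag2_smul_projectiveClosedBall {t : F} (ht : t ≠ 0) (r : Γ) :
    SpecialLinearGroup.toGL (SpecialLinearGroup.diag2 t ht) • projectiveClosedBall v r =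
      projectiveClosedBall v (v t ^ 2 * r) := by
  have hv : 0 < v t ^ 2 := pow_pos (zero_lt_iff.2 (v.ne_zero_iff.2 ht)) 2
  ext x
  constructor
  · rintro ⟨_, ⟨y, hy, rfl⟩, rfl⟩
    simpa [diag2_smul_coe, hv] using hy
  · rintro ⟨y, hy, rfl⟩
    refine ⟨↑((t ^ 2)⁻¹ * y), ?_, by simp [diag2_smul_coe, ht]⟩
    simpa [inv_mul_le_iff₀ hv] using hy

theorem mem_or_smul_mem_projectiveClosedBall_sdiff {r : Γ} (hr : r < 1) (x : OnePoint F) :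
    x ∈ projectiveClosedBall v 1 \ projectiveClosedBall v r ∨
      SpecialLinearGroup.toGL (SpecialLinearGroup.transvection (zero_ne_one' (Fin 2)) (1 : F)) • x ∈
        projectiveClosedBall v 1 \ projectiveClosedBall v r ∨
      SpecialLinearGroup.toGL (SpecialLinearGroup.transvection (one_ne_zero' (Fin 2)) (1 : F)) • x ∈
        projectiveClosedBall v 1 \ projectiveClosedBall v r := by
  have hunit {y : F} (hy : v y = 1) :
      (y : OnePoint F) ∈ projectiveClosedBall v 1 \ projectiveClosedBall v r := by
    simp [hy, hr]
  cases x with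
  | infty =>
    refine .inr (.inr ?_)
    rw [transvection_one_zero_smul_infty one_ne_zero]
    exact hunit (by simp)
  | coe x =>
    rcases lt_or_ge 1 (v x) with hx | hx
    · have hden : v (1 * x + 1) = v x := by
        rw [one_mul, v.map_add_eq_of_lt_left (by simpa using hx)]
      have hx0 : v x ≠ 0 := (zero_lt_one.trans hx).ne'
      refine .inr (.inr ?_)
      rw [transvection_one_zero_smul_coe (v.ne_zero_iff.1 (hden ▸ hx0))]
      exact hunit (by rw [map_div₀, hden, div_self hx0])
    rcases lt_or_ge r (v x) with hx' | hx'
    · exact .inl (by simp [hx, hx'])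
    · refine .inr (.inl ?_)
      rw [transvection_zero_one_smul_coe]
      exact hunit (by rw [add_comm, v.map_one_add_of_lt (hx'.trans_lt hr)])

end Annulus

theorem exists_valuationSubring_notMem {F : Type*} [Field F] {s : F} (hs : ¬ IsIntegral ℤ s) :
    ∃ A : ValuationSubring F, s ∉ A := by
  contrapose! hs
  have hmem : s ∈ ⨅ V : {V : ValuationSubring F // (∅ : Set F) ⊆ V.toSubring}, V.1.toSubring :=
    Subring.mem_iInf.2 fun V => hs V.1
  rw [iInf_valuationSubring_superset] at hmem
  have : Algebra.IsIntegral ℤ (Subring.closure (∅ : Set F)) :=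
    Algebra.isIntegral_of_surjective fun ⟨x, hx⟩ => by
      rw [Subring.closure_empty, Subring.mem_bot] at hx
      obtain ⟨n, rfl⟩ := hx
      exact ⟨n, Subtype.ext (by simp)⟩
  exact isIntegral_trans (A := Subring.closure (∅ : Set F)) s hmem

section SpecialLinear

open Matrix SpecialLinearGroup

theorem map_transvection {R S ι : Type*} [CommRing R] [CommRing S] [Fintype ι] [DecidableEq ι]
    (f : R →+* S) {i j : ι} (hij : i ≠ j) (b : R) :
    SpecialLinearGroup.map f (transvection hij b) = transvection hij (f b) := by
  ext k l
  by_cases h : k = l <;> simp [transvection_coe, Matrix.single_apply, h, apply_ite f]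

theorem map_diag2 {L F : Type*} [Field L] [Field F] (f : L →+* F) {t : L} (ht : t ≠ 0) :
    SpecialLinearGroup.map f (diag2 t ht) = diag2 (f t) ((map_ne_zero f).2 ht) := by
  ext i j
  fin_cases i <;> fin_cases j <;> simp [diag2_coe']

theorem not_isUniformlyInnerAmenable_specialLinearGroup_of_valuation_lt_one {L F Γ : Type*}
    [Field L] [Field F] [IsAlgClosed F] [LinearOrderedCommGroupWithZero Γ] (f : L →+* F)
    (v : Valuation F Γ) {t : L} (ht : t ≠ 0) (hvt : v (f t) < 1) :
    ¬ IsUniformlyInnerAmenable (SpecialLinearGroup (Fin 2) L) := by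
  classical
  let ρ : SpecialLinearGroup (Fin 2) L →* GL (Fin 2) F :=
    toGL.comp (SpecialLinearGroup.map f)
  have hρ : Function.Injective ρ := toGL_injective.comp fun g h hgh =>
    Subtype.ext <| Matrix.map_injective f.injective (congrArg Subtype.val hgh)
  let : MulAction (SpecialLinearGroup (Fin 2) L) (OnePoint F) := MulAction.compHom _ ρ
  have := finite_center_specialLinearGroup (Fin 2) L
  have hfix (g : SpecialLinearGroup (Fin 2) L) (hg : g ∉ Subgroup.center _) :
      (fixedBy (OnePoint F) g).ncard ∈ Set.Icc 1 2 := by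
    refine ncard_fixedBy_onePoint_mem_Icc (g := ρ g) fun h => hg ?_
    refine Subgroup.mem_center_iff.2 fun x => hρ ?_
    rw [map_mul, map_mul, Subgroup.mem_center_iff.1 h]
  have hball : diag2 t ht • projectiveClosedBall v 1 = projectiveClosedBall v (v (f t) ^ 2) := by
    change ρ (diag2 t ht) • projectiveClosedBall v 1 = _
    simp [ρ, map_diag2, diag2_smul_projectiveClosedBall]
  have hlt : v (f t) ^ 2 < 1 := pow_lt_one₀ zero_le hvt two_ne_zero
  refine not_isUniformlyInnerAmenable_of_smul_cover hfix (a := diag2 t ht)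
    (B := projectiveClosedBall v 1)
    (P := {1, transvection (zero_ne_one' (Fin 2)) 1, transvection (one_ne_zero' (Fin 2)) 1})
    (hball ▸ projectiveClosedBall_mono v hlt.le) fun x => ?_
  rw [hball]
  simpa only [Finset.mem_insert, Finset.mem_singleton, exists_eq_or_imp, exists_eq_left, one_smul,
    compHom_smul_def, ρ, MonoidHom.comp_apply, map_transvection, map_one] using
    mem_or_smul_mem_projectiveClosedBall_sdiff v hlt x

theorem not_isUniformlyInnerAmenable_specialLinearGroup_of_not_isIntegral {L : Type*} [Field L]
    {s : L} (hs : ¬ IsIntegral ℤ s) :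
    ¬ IsUniformlyInnerAmenable (SpecialLinearGroup (Fin 2) L) := by
  let f := algebraMap L (AlgebraicClosure L)
  obtain ⟨A, hA⟩ :=
    exists_valuationSubring_notMem ((isIntegral_algebraMap_iff f.injective).not.2 hs)
  have hs0 : s ≠ 0 := by
    rintro rfl
    exact hs isIntegral_zero
  refine not_isUniformlyInnerAmenable_specialLinearGroup_of_valuation_lt_one f A.valuation
    (inv_ne_zero hs0) ?_
  rw [← A.valuation_le_one_iff, not_le] at hA
  rw [map_inv₀, map_inv₀]
  exact inv_lt_one_of_one_lt₀ hA

end SpecialLinear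

section ReducedPower

variable {ι α β : Type*}

/-- `φ` exhibits `β` as the reduced power of `α` modulo the filter `l`: it is surjective, and it
identifies two families exactly when they agree along `l`. For an ultrafilter this is an
ultrapower. -/
structure IsReducedPowerMap (l : Filter ι) (φ : (ι → α) → β) : Prop where
  surjective : Function.Surjective φ
  apply_eq_iff (x y : ι → α) : φ x = φ y ↔ ∀ᶠ i in l, x i = y i

namespace IsReducedPowerMap

theorem germ_coe (l : Filter ι) :
    IsReducedPowerMap l fun x : ι → α => (x : Filter.Germ l α) where
  surjective := Quotient.mk_surjective
  apply_eq_iff _ _ := Filter.Germ.coe_eq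

theorem eventually_apply_eq_iff {U : Ultrafilter ι} {φ : (ι → α) → β}
    (hφ : IsReducedPowerMap U φ) (x y : ι → α) : ∀ᶠ i in U, (φ x = φ y ↔ x i = y i) := by
  by_cases h : φ x = φ y
  · filter_upwards [(hφ.apply_eq_iff x y).1 h] with i hi
    simp only [h, hi]
  · filter_upwards [U.eventually_not.2 (mt (hφ.apply_eq_iff x y).2 h)] with i hi
    simp only [h, hi]

end IsReducedPowerMap

theorem exists_range_fin_eq {T : Finset α} (hT : T.Nonempty) {m : ℕ} (hm : T.card ≤ m) :
    ∃ τ : Fin m → α, Set.range τ = T := by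
  have := hT.to_subtype
  obtain ⟨e⟩ : Nonempty (T ↪ Fin m) :=
    Function.Embedding.nonempty_of_card_le (by simpa using hm)
  refine ⟨Subtype.val ∘ Function.invFun e, ?_⟩
  rw [(Function.invFun_surjective e.injective).range_comp, Subtype.range_coe]

variable {G H : Type*} [Group G] [Group H] {U : Ultrafilter ι} {φ : (ι → G) →* H}

namespace IsReducedPowerMap

theorem exists_card_eq_conjDefect_eq (hφ : IsReducedPowerMap U φ) (S : Finset (ι → G))
    {T : ι → Finset G} (hne : ∀ i, (T i).Nonempty) {m : ℕ} (hm : ∀ i, (T i).card ≤ m) :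
    ∃ (i : ι) (T' : Finset H), T'.card = (T i).card ∧
      ∀ s ∈ S, conjDefect (φ s) T' = conjDefect (s i) (T i) := by
  classical
  choose τ hτ using fun i => exists_range_fin_eq (hne i) (hm i)
  let τ' : Fin m → ι → G := fun j i => τ i j
  obtain ⟨i, hinj, hconj⟩ : ∃ i, (∀ j k, φ (τ' j) = φ (τ' k) ↔ τ i j = τ i k) ∧
      ∀ s ∈ S, ∀ j k, φ (s * τ' j * s⁻¹) = φ (τ' k) ↔ s i * τ i j * (s i)⁻¹ = τ i k := by
    refine Filter.Eventually.exists (f := (U : Filter ι)) (.and ?_ ?_)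
    · exact Filter.eventually_all.2 fun j => Filter.eventually_all.2 fun k =>
        hφ.eventually_apply_eq_iff (τ' j) (τ' k)
    · exact (Filter.eventually_all_finset S).2 fun s _ => Filter.eventually_all.2 fun j =>
        Filter.eventually_all.2 fun k => hφ.eventually_apply_eq_iff (s * τ' j * s⁻¹) (τ' k)
  obtain ⟨θ, hθ⟩ : ∃ θ : G → H, ∀ j, θ (τ i j) = φ (τ' j) :=
    ⟨Function.extend (τ i) (fun j => φ (τ' j)) 1,
      Function.FactorsThrough.extend_apply (fun j k h => (hinj j k).2 h) 1⟩
  have hmem (x : G) (hx : x ∈ T i) : ∃ j, τ i j = x :=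
    (hτ i).ge hx
  have hθinj : Set.InjOn θ (T i) := by
    intro x hx y hy hxy
    obtain ⟨j, rfl⟩ := hmem x hx
    obtain ⟨k, rfl⟩ := hmem y hy
    rwa [hθ, hθ, hinj] at hxy
  refine ⟨i, (T i).image θ, Finset.card_image_of_injOn hθinj, fun s hs => ?_⟩
  refine conjDefect_image hθinj fun x hx y hy => ?_
  obtain ⟨j, rfl⟩ := hmem x hx
  obtain ⟨k, rfl⟩ := hmem y hy
  rw [hθ, hθ, ← hconj s hs j k, map_mul, map_mul, map_inv]

theorem isUniformlyInnerAmenable (hφ : IsReducedPowerMap U φ) (hG : IsUniformlyInnerAmenable G) :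
    IsUniformlyInnerAmenable H := by
  classical
  obtain ⟨f, hf⟩ := hG
  refine ⟨f, fun n hn S hS hSn => ?_⟩
  let lift : H → ι → G := Function.surjInv hφ.surjective
  have hlift (h : H) : φ (lift h) = h := Function.surjInv_eq hφ.surjective h
  choose T hnT hTf hT using fun i => hf n hn (S.image fun h => lift h i) (hS.image _)
    (Finset.card_image_le.trans hSn)
  obtain ⟨i, T', hcard, hdefect⟩ := hφ.exists_card_eq_conjDefect_eq (S.image lift)
    (fun i => (hT i).1) hTf
  refine ⟨T', hcard ▸ hnT i, hcard ▸ hTf i, isConjFolnerSet_iff.2 ⟨?_, fun h hh => ?_⟩⟩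
  · rw [← Finset.card_pos, hcard]
    exact (hT i).1.card_pos
  · have := hdefect (lift h) (Finset.mem_image_of_mem _ hh)
    rw [hlift] at this
    rw [this, hcard]
    exact (isConjFolnerSet_iff.1 (hT i)).2 _ (Finset.mem_image_of_mem _ hh)

end IsReducedPowerMap

end ReducedPower

section Ultrapower

open Matrix

variable {ι n R S : Type*} [DecidableEq n] [Fintype n] [CommRing R] [CommRing S]

/-- The homomorphism `SL n R ^ ι → SL n S` induced by a ring homomorphism `R ^ ι → S`. -/
def specialLinearGroupPiMap (ψ : (ι → R) →+* S) :
    (ι → SpecialLinearGroup n R) →* SpecialLinearGroup n S :=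
  (SpecialLinearGroup.map ψ).comp
    { toFun x := ⟨Matrix.of fun i j k => x k i j, by
        funext k
        exact (RingHom.map_det (Pi.evalRingHom (fun _ => R) k) _).trans (x k).2⟩
      map_one' := by
        ext i j k
        by_cases h : i = j <;> simp [h, Matrix.one_apply]
      map_mul' x y := by
        ext i j k
        exact (Finset.sum_apply k Finset.univ fun l k => x k i l * y k l j).symm }

theorem specialLinearGroupPiMap_apply (ψ : (ι → R) →+* S) (x : ι → SpecialLinearGroup n R)
    (i j : n) : specialLinearGroupPiMap ψ x i j = ψ fun k => x k i j :=
  rfl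

theorem isReducedPowerMap_specialLinearGroupPiMap {l : Filter ι} {ψ : (ι → R) →+* S}
    (hψ : IsReducedPowerMap l ψ) :
    IsReducedPowerMap l (specialLinearGroupPiMap (n := n) ψ) where
  apply_eq_iff x y := by
    simp only [Matrix.SpecialLinearGroup.ext_iff, Filter.eventually_all]
    exact forall_congr' fun i => forall_congr' fun j => hψ.apply_eq_iff _ _
  surjective g := by
    classical
    choose x hx using fun i j => hψ.surjective (g i j)
    let A : ι → Matrix n n R := fun k => Matrix.of fun i j => x i j k
    have hA : ∀ᶠ k in l, (A k).det = 1 := by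
      refine (hψ.apply_eq_iff (fun k => (A k).det) 1).1 ?_
      have hdet : (fun k => (A k).det) = (Matrix.of x).det :=
        funext fun k => ((Pi.evalRingHom (fun _ => R) k).map_det (Matrix.of x)).symm
      rw [hdet, ψ.map_det, map_one, ← g.det_coe]
      exact congrArg Matrix.det (Matrix.ext hx)
    refine ⟨fun k => if h : (A k).det = 1 then ⟨A k, h⟩ else 1, ?_⟩
    ext i j
    rw [specialLinearGroupPiMap_apply, ← hx i j, hψ.apply_eq_iff]
    filter_upwards [hA] with k hk
    simp [hk, A]

theorem not_isIntegral_germ_coe {K : Type*} [Field K] {s : ℕ → K} (hs : Function.Injective s) :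
    ¬ IsIntegral ℤ (s : Filter.Germ (Filter.hyperfilter ℕ : Filter ℕ) K) := by
  rintro ⟨p, hp, h⟩
  have hgerm : ((fun i => p.eval₂ (Int.castRingHom K) (s i) : ℕ → K) :
      Filter.Germ (Filter.hyperfilter ℕ : Filter ℕ) K) = 0 := by
    rw [← h]
    have heval : (fun i => p.eval₂ (Int.castRingHom K) (s i)) =
        p.eval₂ (Int.castRingHom (ℕ → K)) s := funext fun i => by
      rw [← Pi.evalRingHom_apply (fun _ => K) i (p.eval₂ _ s), Polynomial.hom_eval₂]
      rfl
    rw [heval, ← Filter.Germ.coe_coeRingHom, Polynomial.hom_eval₂]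
    rfl
  have hroot : ∀ᶠ i in (Filter.hyperfilter ℕ : Filter ℕ),
      (p.map (Int.castRingHom K)).IsRoot (s i) := by
    filter_upwards [Filter.Germ.coe_eq.1 hgerm] with i hi
    rwa [Polynomial.IsRoot.def, Polynomial.eval_map]
  have hfinite : {i | (p.map (Int.castRingHom K)).IsRoot (s i)}.Finite :=
    ((p.map (Int.castRingHom K)).finite_setOfPred_isRoot (hp.map _).ne_zero).preimage hs.injOn
  exact Filter.notMem_hyperfilter_of_finite hfinite hroot

theorem not_isUniformlyInnerAmenable_specialLinearGroup (K : Type*) [Field K] [Infinite K] :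
    ¬ IsUniformlyInnerAmenable (SpecialLinearGroup (Fin 2) K) := fun h =>
  have hφ := isReducedPowerMap_specialLinearGroupPiMap (n := Fin 2)
    (ψ := Filter.Germ.coeRingHom (Filter.hyperfilter ℕ : Filter ℕ)) (.germ_coe (α := K) _)
  not_isUniformlyInnerAmenable_specialLinearGroup_of_not_isIntegral
    (not_isIntegral_germ_coe (Infinite.natEmbedding K).injective) (hφ.isUniformlyInnerAmenable h)

end Ultrapower

section Amenable

open MeasureTheory Filter

theorem isAmenableAction_of_isFoelner {G X ι : Type*} [Group G] [MulAction G X]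
    [MeasurableSpace X] [DiscreteMeasurableSpace X] {μ : Measure X} [SMulInvariantMeasure G X μ]
    {l : Filter ι} [NeBot l] {F : ι → Set X} (hF : IsFoelner G μ l F) : IsAmenableAction G X := by
  obtain ⟨m, hm_univ, hm_union, hm_smul⟩ := hF.amenable
  have hm_ne_top (s : Set X) : m s ≠ ⊤ := by
    have h := hm_union s sᶜ .of_discrete disjoint_compl_right
    rw [Set.union_compl_self, hm_univ] at h
    exact (ENNReal.add_ne_top.1 (h ▸ ENNReal.one_ne_top)).1
  refine ⟨fun s => (m s).toReal, fun s => ENNReal.toReal_nonneg, by simp [hm_univ],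
    fun s t hst => ?_, fun g s => congrArg ENNReal.toReal (hm_smul g s)⟩
  simp only [hm_union s t .of_discrete hst, ENNReal.toReal_add (hm_ne_top s) (hm_ne_top t)]

/-- A group is locally finite if its finitely generated subgroups are finite. -/
def IsLocallyFiniteGroup (G : Type*) [Group G] : Prop :=
  ∀ S : Finset G, (Subgroup.closure (S : Set G) : Set G).Finite

theorem IsLocallyFiniteGroup.isFoelner_closure {G : Type*} [Group G] [MeasurableSpace G]
    [DiscreteMeasurableSpace G] (hG : IsLocallyFiniteGroup G) :
    IsFoelner G Measure.count atTop fun S : Finset G => (Subgroup.closure (S : Set G) : Set G) where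
  eventually_measurableSet := .of_forall fun _ => .of_discrete
  eventually_meas_ne_zero := .of_forall fun S =>
    Measure.count_ne_zero ⟨1, Subgroup.one_mem _⟩
  eventually_meas_ne_top := .of_forall fun S => (Measure.count_apply_lt_top.2 (hG S)).ne
  tendsto_meas_smul_symmDiff g := by
    refine tendsto_const_nhds.congr' ?_
    filter_upwards [eventually_ge_atTop {g}] with S hS
    have hg : g ∈ Subgroup.closure (S : Set G) :=
      Subgroup.subset_closure (hS (Finset.mem_singleton_self g))
    simp [smul_coe_set hg]

theorem IsLocallyFiniteGroup.isAmenableGroup {G : Type*} [Group G] (hG : IsLocallyFiniteGroup G) :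
    IsAmenableGroup G := by
  let : MeasurableSpace G := ⊤
  have : DiscreteMeasurableSpace G := ⟨fun _ => trivial⟩
  exact isAmenableAction_of_isFoelner hG.isFoelner_closure

end Amenable

section LocallyFinite

open Matrix

variable {n : Type*} [Fintype n] [DecidableEq n]

theorem mem_range_specialLinearGroup_map {R S : Type*} [CommRing R] [CommRing S] {f : R →+* S}
    (hf : Function.Injective f) {g : SpecialLinearGroup n S} (hg : ∀ i j, g i j ∈ f.range) :
    g ∈ (SpecialLinearGroup.map (n := n) f).range := by
  choose A hA using hg
  have hmap : f.mapMatrix (Matrix.of A) = g := Matrix.ext hA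
  refine ⟨⟨Matrix.of A, hf ?_⟩, Subtype.ext hmap⟩
  rw [f.map_det, hmap, g.det_coe, map_one]

theorem isLocallyFiniteGroup_specialLinearGroup (k : Type*) {K : Type*} [Field k] [Finite k]
    [Field K] [Algebra k K] [Algebra.IsAlgebraic k K] :
    IsLocallyFiniteGroup (SpecialLinearGroup n K) := fun S => by
  let E : Set K := ⋃ g ∈ S, ⋃ i, Set.range (g i)
  have : Finite E := S.finite_toSet.biUnion fun g _ => Set.finite_iUnion fun i =>
    Set.finite_range _
  let L := IntermediateField.adjoin k E
  have : FiniteDimensional k L :=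
    IntermediateField.finiteDimensional_adjoin fun x _ => Algebra.IsIntegral.isIntegral x
  have : Finite L := Module.finite_of_finite k
  have hle : Subgroup.closure (S : Set (SpecialLinearGroup n K)) ≤
      (SpecialLinearGroup.map (n := n) (algebraMap L K)).range := by
    refine (Subgroup.closure_le _).2 fun g hg => ?_
    refine mem_range_specialLinearGroup_map (algebraMap L K).injective fun i j => ?_
    have hE : g i j ∈ E := Set.mem_biUnion hg (Set.mem_iUnion_of_mem i (Set.mem_range_self j))
    exact ⟨⟨g i j, IntermediateField.subset_adjoin k E hE⟩, rfl⟩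
  exact (Set.finite_range (SpecialLinearGroup.map (n := n) (algebraMap L K))).subset hle

end LocallyFinite

theorem mainTheorem4_general (k K : Type*) [Field k] [Finite k] [Field K] [Algebra k K]
    [Algebra.IsAlgebraic k K] [Infinite K] :
    IsAmenableGroup (Matrix.SpecialLinearGroup (Fin 2) K) ∧
      ¬ IsUniformlyInnerAmenable (Matrix.SpecialLinearGroup (Fin 2) K) :=
  ⟨(isLocallyFiniteGroup_specialLinearGroup k).isAmenableGroup,
    not_isUniformlyInnerAmenable_specialLinearGroup K⟩

theorem mainTheorem4 :
    IsAmenableGroup (Matrix.SpecialLinearGroup (Fin 2) (AlgebraicClosure (ZMod 2))) ∧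
      ¬ IsUniformlyInnerAmenable
        (Matrix.SpecialLinearGroup (Fin 2) (AlgebraicClosure (ZMod 2))) :=
  mainTheorem4_general (ZMod 2) (AlgebraicClosure (ZMod 2))
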